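/- Theorem 1. Let $E_1, E_2\subset\mathbb{R}^3$ be two (solid, nondegenerate) ellipsoids, with arbitrary centres and axes. For a convex body $K\subset\mathbb{R}^3$ let the surface area be $$S(K)=\lim_{t\to0^+}\frac{\mathrm{Vol}(K+tB)-\mathrm{Vol}(K)}{t},$$ where $B$ is the closed unit ball (this is the coefficient of $t$ in the Steiner polynomial $\mathrm{Vol}(K+tB)$), and let the mean width be the average over unit vectors $u\in S^2$, with respect to the rotation-invariant probability measure, of $\max_{x\in K}\langle x,u\rangle-\min_{x\in K}\langle x,u\rangle$. If $E_1$ and $E_2$ have the same volume, the same surface area and the same mean width, then they are congruent, i.e. some isometry of $\mathbb{R}^3$ maps $E_1$ onto $E_2$. -/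

import Mathlib

open MeasureTheory Metric Set Filter Topology
open scoped Pointwise

/-- The solid ellipsoid centred at the origin whose axes are the coordinate axes and whose
semiaxes are `a 0, …, a (n - 1)`. -/
def standardEllipsoid {n : ℕ} (a : Fin n → ℝ) : Set (EuclideanSpace ℝ (Fin n)) :=
  {x | ∑ i, x i ^ 2 / a i ^ 2 ≤ 1}

/-- A (nondegenerate, solid) ellipsoid in `ℝⁿ`, with any centre and any axes: the image under an
isometry of `ℝⁿ` of a standard ellipsoid with positive semiaxes. -/
def IsEllipsoid {n : ℕ} (K : Set (EuclideanSpace ℝ (Fin n))) : Prop :=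
  ∃ (a : Fin n → ℝ) (φ : EuclideanSpace ℝ (Fin n) ≃ᵢ EuclideanSpace ℝ (Fin n)),
    (∀ i, 0 < a i) ∧ K = φ '' standardEllipsoid a

/-- Two sets in `ℝⁿ` are congruent if an isometry of `ℝⁿ` carries one onto the other. -/
def AreCongruent {n : ℕ} (K L : Set (EuclideanSpace ℝ (Fin n))) : Prop :=
  ∃ φ : EuclideanSpace ℝ (Fin n) ≃ᵢ EuclideanSpace ℝ (Fin n), φ '' K = L

/-- The surface area of a convex body `K` in `ℝⁿ` in the sense of Minkowski: the right derivative
at `t = 0` of the volume of the outer parallel body `K + t B`, where `B` is the closed unit ball.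
It is the coefficient of `t` in the Steiner polynomial of `K`. -/
noncomputable def surfaceArea {n : ℕ} (K : Set (EuclideanSpace ℝ (Fin n))) : ℝ :=
  limUnder (𝓝[>] (0 : ℝ)) fun t : ℝ =>
    (volume.real (K + t • closedBall (0 : EuclideanSpace ℝ (Fin n)) 1) - volume.real K) / t

/-- The width of `K` in the direction of the unit vector `u`: the distance between the two
supporting hyperplanes of `K` orthogonal to `u`. -/
noncomputable def width {n : ℕ} (K : Set (EuclideanSpace ℝ (Fin n)))
    (u : EuclideanSpace ℝ (Fin n)) : ℝ :=
  sSup ((fun x => inner ℝ x u) '' K) - sInf ((fun x => inner ℝ x u) '' K)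

/-- The mean width of `K`: the average of the width over the unit sphere, with respect to the
rotation-invariant surface measure. -/
noncomputable def meanWidth {n : ℕ} (K : Set (EuclideanSpace ℝ (Fin n))) : ℝ :=
  ⨍ u : sphere (0 : EuclideanSpace ℝ (Fin n)) 1, width K u
    ∂(volume : Measure (EuclideanSpace ℝ (Fin n))).toSphere

/-! ### The kernel `s ↦ s ^ (-3/2)` -/

/-! Write an ellipsoid, up to isometry, as `A B` with `A` diagonal with entries `a i`. Its support
function is `‖A u‖`, so the mean width is a multiple of the integral of `‖A u‖` over the sphere.
Since `A B + t B = A (B + t A⁻¹ B)`, the surface area is `det A` times the integral of `‖A⁻¹ u‖`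
(`tendsto_measureReal_ball_add_smul`). The volume fixes `det A`, so both sphere integrals are known.

By homogeneity each is a multiple of a Gaussian integral over the whole space. Writing `√q` as a
multiple of `∫ (1 - exp (-s q)) s ^ (-3/2) ds` turns it into a multiple of `∫ (1 - D(s) ^ (-1/2)) s
^ (-3/2) ds`, where `D(s) = ∏ (1 + s a_i²) = 1 + x s + y s² + z s³` (`sphereIntegral_eq`). For `A⁻¹`
the coefficients are `y/z, x/z, 1/z`.

Let two ellipsoids share all the data, with cubics `D`, `D'` and the same `z`, and put `h = D ^
(-1/2) - D' ^ (-1/2)`. Then `∫ h s ^ (-3/2) = 0`, and after `s ↦ 1/s` the second equality reads `∫ h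
s = 0`. But `h` has the sign of `D' - D = s ((x' - x) + (y' - y) s)`, which changes at most once on
the half-line. A combination of the two weights changing sign at the same point gives an integrand
of constant sign with zero integral, so `D = D'` (`cubicIntegral_injective`). Hence the `a_i²` agree
up to a permutation. -/

/-- Near `0` the linear bound leaves `s ^ (-1/2)`; at infinity boundedness leaves `s ^ (-3/2)`. -/
lemma integrableOn_mul_rpow_neg_three_halves {f : ℝ → ℝ} {C : ℝ}
    (hf : ContinuousOn f (Ioi 0)) (h0 : ∀ s, 0 < s → 0 ≤ f s) (h1 : ∀ s, 0 < s → f s ≤ 1)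
    (hC : ∀ s, 0 < s → s ≤ 1 → f s ≤ C * s) :
    IntegrableOn (fun s => f s * s ^ (-3 / 2 : ℝ)) (Ioi 0) := by
  have hcont : ContinuousOn (fun s : ℝ => f s * s ^ (-3 / 2 : ℝ)) (Ioi 0) :=
    hf.mul (continuousOn_id.rpow_const fun s hs => Or.inl (ne_of_gt hs))
  have hmeas := hcont.aestronglyMeasurable measurableSet_Ioi (μ := volume)
  rw [← Ioc_union_Ioi_eq_Ioi (zero_le_one (α := ℝ)), integrableOn_union]
  constructor
  · have hi : IntegrableOn (fun s : ℝ => C * s ^ (-1 / 2 : ℝ)) (Ioc 0 1) :=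
      ((intervalIntegrable_iff_integrableOn_Ioc_of_le zero_le_one).1
        (intervalIntegral.intervalIntegrable_rpow' (by norm_num))).const_mul C
    refine hi.mono' (hmeas.mono_measure (Measure.restrict_mono Ioc_subset_Ioi_self le_rfl)) ?_
    filter_upwards [ae_restrict_mem measurableSet_Ioc] with s hs
    have hp : 0 < s ^ (-3 / 2 : ℝ) := Real.rpow_pos_of_pos hs.1 _
    rw [Real.norm_of_nonneg (mul_nonneg (h0 s hs.1) hp.le)]
    have : s ^ (-1 / 2 : ℝ) = s * s ^ (-3 / 2 : ℝ) := by
      rw [← Real.rpow_one_add' hs.1.le (by norm_num)]; norm_num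
    rw [this, ← mul_assoc]
    exact mul_le_mul_of_nonneg_right (hC s hs.1 hs.2) hp.le
  · have hi : IntegrableOn (fun s : ℝ => s ^ (-3 / 2 : ℝ)) (Ioi 1) :=
      integrableOn_Ioi_rpow_of_lt (by norm_num) one_pos
    refine hi.mono' (hmeas.mono_measure
      (Measure.restrict_mono (Ioi_subset_Ioi zero_le_one) le_rfl)) ?_
    filter_upwards [ae_restrict_mem measurableSet_Ioi] with s hs
    have hs0 : (0 : ℝ) < s := one_pos.trans hs
    have hp : 0 < s ^ (-3 / 2 : ℝ) := Real.rpow_pos_of_pos hs0 _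
    rw [Real.norm_of_nonneg (mul_nonneg (h0 s hs0) hp.le)]
    exact mul_le_of_le_one_left hp.le (h1 s hs0)

/-- The constant `∫₀^∞ (1 - exp (-s)) s ^ (-3/2) ds` normalising the integral representation of the
square root. -/
noncomputable def sqrtConst : ℝ := ∫ s in Ioi (0 : ℝ), (1 - Real.exp (-s)) * s ^ (-3 / 2 : ℝ)

lemma one_sub_exp_neg_nonneg {s : ℝ} (hs : 0 ≤ s) : 0 ≤ 1 - Real.exp (-s) := by
  simpa using hs

lemma integrableOn_one_sub_exp :
    IntegrableOn (fun s : ℝ => (1 - Real.exp (-s)) * s ^ (-3 / 2 : ℝ)) (Ioi 0) := by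
  refine integrableOn_mul_rpow_neg_three_halves (C := 1) (by fun_prop)
    (fun s hs => one_sub_exp_neg_nonneg hs.le) (fun s _ => by linarith [Real.exp_pos (-s)])
    fun s _ _ => by linarith [Real.add_one_le_exp (-s)]

/-- Scaling `s ↦ q s` extracts `q ^ (3/2) * q⁻¹` from the kernel and the measure. -/
lemma integral_one_sub_exp_mul {q : ℝ} (hq : 0 ≤ q) :
    ∫ s in Ioi (0 : ℝ), (1 - Real.exp (-(s * q))) * s ^ (-3 / 2 : ℝ) = √q * sqrtConst := by
  rcases hq.eq_or_lt with rfl | hq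
  · simp
  have h := integral_comp_mul_left_Ioi
    (fun s : ℝ => (1 - Real.exp (-s)) * s ^ (-3 / 2 : ℝ)) 0 hq
  rw [mul_zero, smul_eq_mul] at h
  have hqq : q ^ (3 / 2 : ℝ) * q⁻¹ = √q := by
    rw [← Real.rpow_neg_one, ← Real.rpow_add hq, Real.sqrt_eq_rpow]; norm_num
  rw [← hqq, mul_assoc, sqrtConst, ← h, ← integral_const_mul]
  refine setIntegral_congr_fun measurableSet_Ioi fun s hs => ?_
  have hs' : (0 : ℝ) ≤ s := le_of_lt hs
  rw [Real.mul_rpow hq.le hs', mul_comm s q]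
  have : q ^ (3 / 2 : ℝ) * q ^ (-3 / 2 : ℝ) = 1 := by
    rw [← Real.rpow_add hq]; norm_num
  linear_combination (-(1 - Real.exp (-(q * s))) * s ^ (-3 / 2 : ℝ)) * this

/-! ### A cubic is determined by two integrals -/

/-- The integral `∫₀^∞ (1 - D(s) ^ (-1/2)) s ^ (-3/2) ds` for `D(s) = 1 + x s + y s² + z s³`. -/
noncomputable def cubicIntegral (x y z : ℝ) : ℝ :=
  ∫ s in Ioi (0 : ℝ), (1 - (√(1 + x * s + y * s ^ 2 + z * s ^ 3))⁻¹) * s ^ (-3 / 2 : ℝ)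

lemma one_le_cubic {x y z s : ℝ} (hx : 0 ≤ x) (hy : 0 ≤ y) (hz : 0 ≤ z) (hs : 0 < s) :
    1 ≤ 1 + x * s + y * s ^ 2 + z * s ^ 3 := by
  have : 0 ≤ x * s + y * s ^ 2 + z * s ^ 3 := by positivity
  linarith

lemma integrableOn_cubic {x y z : ℝ} (hx : 0 ≤ x) (hy : 0 ≤ y) (hz : 0 ≤ z) :
    IntegrableOn (fun s : ℝ =>
      (1 - (√(1 + x * s + y * s ^ 2 + z * s ^ 3))⁻¹) * s ^ (-3 / 2 : ℝ)) (Ioi 0) := by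
  have key : ∀ s : ℝ, 0 < s → 1 ≤ √(1 + x * s + y * s ^ 2 + z * s ^ 3) := fun s hs =>
    Real.one_le_sqrt.2 (one_le_cubic hx hy hz hs)
  refine integrableOn_mul_rpow_neg_three_halves (C := x + y + z) ?_ ?_ ?_ ?_
  · refine continuousOn_const.sub (ContinuousOn.inv₀ (by fun_prop) fun s hs => ?_)
    linarith [key s hs]
  · intro s hs
    linarith [inv_le_one_of_one_le₀ (key s hs)]
  · intro s hs
    have := inv_pos.2 (one_pos.trans_le (key s hs))
    linarith
  · intro s hs hs1
    have h1 := key s hs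
    have hsq := Real.sq_sqrt (zero_le_one.trans (one_le_cubic hx hy hz hs))
    set r := √(1 + x * s + y * s ^ 2 + z * s ^ 3)
    -- This is `r + r⁻¹ ≥ 2`; then `r - 1 ≤ r² - 1 = x s + y s² + z s³`, because `r ≥ 1`.
    have hr : 1 - r⁻¹ ≤ r - 1 := by
      have hr0 : 0 < r := by linarith
      have : r⁻¹ * r = 1 := inv_mul_cancel₀ hr0.ne'
      have := inv_pos.2 hr0
      nlinarith
    have h2 : s ^ 2 ≤ s := by nlinarith
    have h3 : s ^ 3 ≤ s := by nlinarith
    nlinarith [mul_le_mul_of_nonneg_left h2 hy, mul_le_mul_of_nonneg_left h3 hz]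

/-- The substitution `s ↦ 1 / s` exchanges the roles of the two middle coefficients. -/
lemma cubic_inv_substitution {x y z s : ℝ} (hx : 0 ≤ x) (hy : 0 ≤ y) (hz : 0 < z) (hs : 0 < s) :
    (√(1 + y / z * s⁻¹ + x / z * s⁻¹ ^ 2 + 1 / z * s⁻¹ ^ 3))⁻¹
      = √z * s ^ (3 / 2 : ℝ) * (√(1 + x * s + y * s ^ 2 + z * s ^ 3))⁻¹ := by
  have h : 1 + y / z * s⁻¹ + x / z * s⁻¹ ^ 2 + 1 / z * s⁻¹ ^ 3
      = (1 + x * s + y * s ^ 2 + z * s ^ 3) / (z * s ^ 3) := by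
    field_simp
    ring
  have h3 : √(s ^ 3) = s ^ (3 / 2 : ℝ) := by
    rw [Real.sqrt_eq_rpow, ← Real.rpow_natCast, ← Real.rpow_mul hs.le]; norm_num
  rw [h, Real.sqrt_div (zero_le_one.trans (one_le_cubic hx hy hz.le hs)), inv_div,
    Real.sqrt_mul hz.le, h3, div_eq_mul_inv]

lemma exists_sign_change {α β : ℝ} (h : 0 < β ∨ β = 0 ∧ 0 < α) :
    ∃ t₀, 0 ≤ t₀ ∧ (∀ t, t₀ < t → 0 < α + β * t) ∧ ∀ t, 0 < t → t ≤ t₀ → α + β * t ≤ 0 := by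
  rcases h with h | ⟨rfl, h⟩
  -- A root to the left of `0` is replaced by `0`: there is then no sign change on the half-line.
  · refine ⟨max (-α / β) 0, le_max_right _ _, fun t ht => ?_, fun t ht0 ht => ?_⟩
    · have := (div_lt_iff₀ h).1 ((le_max_left _ _).trans_lt ht)
      linarith
    · have := (le_max_iff.1 ht).resolve_right (not_le.2 ht0)
      have := (le_div_iff₀ h).1 this
      linarith
  · exact ⟨0, le_rfl, fun t _ => by simpa, fun t ht0 ht => absurd ht (not_le.2 ht0)⟩

lemma sub_inv_sqrt_pos_iff {A B : ℝ} (hA : 0 < A) (hB : 0 < B) :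
    0 < (√A)⁻¹ - (√B)⁻¹ ↔ 0 < B - A := by
  rw [sub_pos, sub_pos, inv_lt_inv₀ (Real.sqrt_pos.2 hB) (Real.sqrt_pos.2 hA),
    Real.sqrt_lt_sqrt_iff hA.le]

/-- The single-crossing argument. `hlt` says that `D' - D` is eventually positive; the opposite case
follows by exchanging the two cubics. -/
lemma not_cubicIntegral_eq {x y x' y' z : ℝ} (hx : 0 ≤ x) (hy : 0 ≤ y) (hx' : 0 ≤ x')
    (hy' : 0 ≤ y') (hz : 0 < z) (hlt : 0 < y' - y ∨ y' - y = 0 ∧ 0 < x' - x)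
    (h₁ : cubicIntegral x y z = cubicIntegral x' y' z)
    (h₂ : cubicIntegral (y / z) (x / z) (1 / z) = cubicIntegral (y' / z) (x' / z) (1 / z)) :
    False := by
  have hyz : 0 ≤ y / z := by positivity
  have hxz : 0 ≤ x / z := by positivity
  have hyz' : 0 ≤ y' / z := by positivity
  have hxz' : 0 ≤ x' / z := by positivity
  have hzz : 0 ≤ 1 / z := by positivity
  set D : ℝ → ℝ := fun s => 1 + x * s + y * s ^ 2 + z * s ^ 3 with hD
  set D' : ℝ → ℝ := fun s => 1 + x' * s + y' * s ^ 2 + z * s ^ 3 with hD'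
  set h : ℝ → ℝ := fun s => (√(D s))⁻¹ - (√(D' s))⁻¹ with hh
  have i₁ : IntegrableOn (fun s => h s * s ^ (-3 / 2 : ℝ)) (Ioi 0) := by
    refine ((integrableOn_cubic hx' hy' hz.le).sub (integrableOn_cubic hx hy hz.le)).congr_fun
      (fun s _ => ?_) measurableSet_Ioi
    simp only [hh, hD, hD', Pi.sub_apply]
    ring
  have e₁ : ∫ s in Ioi 0, h s * s ^ (-3 / 2 : ℝ) = 0 := by
    refine Eq.trans ?_ (sub_eq_zero.2 h₁.symm)
    unfold cubicIntegral
    rw [← integral_sub (integrableOn_cubic hx' hy' hz.le) (integrableOn_cubic hx hy hz.le)]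
    refine integral_congr_ae (.of_forall fun s => ?_)
    simp only [hh, hD, hD']
    ring
  set G : ℝ → ℝ := fun s =>
    (1 - (√(1 + y' / z * s + x' / z * s ^ 2 + 1 / z * s ^ 3))⁻¹) * s ^ (-3 / 2 : ℝ) -
    (1 - (√(1 + y / z * s + x / z * s ^ 2 + 1 / z * s ^ 3))⁻¹) * s ^ (-3 / 2 : ℝ) with hG
  have iG : IntegrableOn G (Ioi 0) :=
    (integrableOn_cubic hyz' hxz' hzz).sub (integrableOn_cubic hyz hxz hzz)
  have eG : ∫ s in Ioi 0, G s = 0 := by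
    rw [hG, integral_sub (integrableOn_cubic hyz' hxz' hzz) (integrableOn_cubic hyz hxz hzz)]
    exact sub_eq_zero.2 h₂.symm
  -- Under `s ↦ s⁻¹` the Jacobian gives `s ^ (-2)`, the kernel `s ^ (3/2)` and the cubic another `s
  -- ^ (3/2)`: the weight becomes `s`.
  have hsub : ∀ s ∈ Ioi (0 : ℝ),
      (|(-1 : ℝ)| * s ^ ((-1 : ℝ) - 1)) • G (s ^ (-1 : ℝ)) = √z * (h s * s) := by
    intro s hs
    have hs0 : (0 : ℝ) < s := hs
    simp only [hG, hh, hD, hD', Real.rpow_neg_one]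
    rw [cubic_inv_substitution hx hy hz hs0, cubic_inv_substitution hx' hy' hz hs0,
      smul_eq_mul, abs_neg, abs_one, one_mul]
    have hpow : s ^ ((-1 : ℝ) - 1) * (s⁻¹) ^ (-3 / 2 : ℝ) * s ^ (3 / 2 : ℝ) = s := by
      rw [Real.inv_rpow hs0.le, ← Real.rpow_neg hs0.le, ← Real.rpow_add hs0,
        ← Real.rpow_add hs0]
      norm_num
    linear_combination (√z * ((√(1 + x * s + y * s ^ 2 + z * s ^ 3))⁻¹
      - (√(1 + x' * s + y' * s ^ 2 + z * s ^ 3))⁻¹)) * hpow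
  have hsz : √z ≠ 0 := (Real.sqrt_pos.2 hz).ne'
  have i₂ : IntegrableOn (fun s => h s * s) (Ioi 0) := by
    have := ((integrableOn_Ioi_comp_rpow_iff G (p := -1) (by norm_num)).2 iG).congr_fun hsub
      measurableSet_Ioi
    exact (integrable_const_mul_iff (IsUnit.mk0 _ hsz) _).1 this
  have e₂ : ∫ s in Ioi 0, h s * s = 0 := by
    have := integral_comp_rpow_Ioi G (p := -1) (by norm_num)
    rw [setIntegral_congr_fun measurableSet_Ioi hsub, eG, integral_const_mul] at this
    exact (mul_eq_zero.1 this).resolve_left hsz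
  obtain ⟨t₀, ht₀, hpos, hneg⟩ := exists_sign_change hlt
  have hDpos : ∀ s, 0 < s → 0 < D s := fun s hs => one_pos.trans_le (one_le_cubic hx hy hz.le hs)
  have hDpos' : ∀ s, 0 < s → 0 < D' s :=
    fun s hs => one_pos.trans_le (one_le_cubic hx' hy' hz.le hs)
  have hDD : ∀ s, D' s - D s = s * ((x' - x) + (y' - y) * s) := fun s => by
    simp only [hD, hD']; ring
  have hhpos : ∀ s, 0 < s → (0 < h s ↔ 0 < (x' - x) + (y' - y) * s) := fun s hs => by
    rw [sub_inv_sqrt_pos_iff (hDpos s hs) (hDpos' s hs), hDD, mul_pos_iff_of_pos_left hs]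
  -- The ratio of the two weights is `s ^ (5/2)`, which is increasing, so this coefficient makes the
  -- combined weight vanish exactly where `h` may change sign.
  set φ : ℝ → ℝ := fun s => h s * s - t₀ ^ (5 / 2 : ℝ) * (h s * s ^ (-3 / 2 : ℝ)) with hφ
  have iφ : IntegrableOn φ (Ioi 0) := i₂.sub (i₁.const_mul _)
  have eφ : ∫ s in Ioi 0, φ s = 0 := by
    rw [hφ, integral_sub i₂ (i₁.const_mul _), integral_const_mul, e₁, e₂, mul_zero, sub_zero]
  have φeq : ∀ s, 0 < s → φ s = (s ^ (5 / 2 : ℝ) - t₀ ^ (5 / 2 : ℝ)) * s ^ (-3 / 2 : ℝ) * h s := by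
    intro s hs
    have : s ^ (5 / 2 : ℝ) * s ^ (-3 / 2 : ℝ) = s := by
      rw [← Real.rpow_add hs]; norm_num
    simp only [hφ]
    linear_combination (-h s) * this
  have φpos : ∀ s, t₀ < s → 0 < φ s := by
    intro s hs
    have hs0 := ht₀.trans_lt hs
    rw [φeq s hs0]
    refine mul_pos (mul_pos (sub_pos.2 (Real.rpow_lt_rpow ht₀ hs (by norm_num)))
      (Real.rpow_pos_of_pos hs0 _)) ((hhpos s hs0).2 (hpos s hs))
  have φnonneg : ∀ s, 0 < s → 0 ≤ φ s := by
    intro s hs0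
    rcases lt_or_ge t₀ s with hs | hs
    · exact (φpos s hs).le
    · rw [φeq s hs0]
      refine mul_nonneg_of_nonpos_of_nonpos (mul_nonpos_of_nonpos_of_nonneg (sub_nonpos.2
        (Real.rpow_le_rpow hs0.le hs (by norm_num))) (Real.rpow_nonneg hs0.le _)) ?_
      exact not_lt.1 fun hlt => (hneg s hs0 hs).not_gt ((hhpos s hs0).1 hlt)
  have := (setIntegral_pos_iff_support_of_nonneg_ae
    ((ae_restrict_mem measurableSet_Ioi).mono fun s hs => φnonneg s hs) iφ).2
    (lt_of_lt_of_le (b := volume (Ioi t₀)) (by simp) (measure_mono fun s hs =>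
      ⟨(φpos s hs).ne', ht₀.trans_lt hs⟩))
  exact this.ne' eφ

theorem cubicIntegral_injective {x y x' y' z : ℝ} (hx : 0 ≤ x) (hy : 0 ≤ y) (hx' : 0 ≤ x')
    (hy' : 0 ≤ y') (hz : 0 < z) (h₁ : cubicIntegral x y z = cubicIntegral x' y' z)
    (h₂ : cubicIntegral (y / z) (x / z) (1 / z) = cubicIntegral (y' / z) (x' / z) (1 / z)) :
    x = x' ∧ y = y' := by
  rcases lt_trichotomy y y' with h | h | h
  · exact (not_cubicIntegral_eq hx hy hx' hy' hz (Or.inl (sub_pos.2 h)) h₁ h₂).elim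
  · refine ⟨?_, h⟩
    rcases lt_trichotomy x x' with hh | hh | hh
    · exact (not_cubicIntegral_eq hx hy hx' hy' hz
        (Or.inr ⟨sub_eq_zero.2 h.symm, sub_pos.2 hh⟩) h₁ h₂).elim
    · exact hh
    · exact (not_cubicIntegral_eq hx' hy' hx hy hz
        (Or.inr ⟨sub_eq_zero.2 h, sub_pos.2 hh⟩) h₁.symm h₂.symm).elim
  · exact (not_cubicIntegral_eq hx' hy' hx hy hz (Or.inl (sub_pos.2 h)) h₁.symm h₂.symm).elim

/-! ### Gaussian integrals -/

/-- Tonelli for real-valued integrals: nonnegativity and integrability of the slices replace joint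
integrability. -/
lemma integral_integral_swap_of_nonneg {α β : Type*} [MeasurableSpace α] [MeasurableSpace β]
    {μ : Measure α} {ν : Measure β} [SFinite μ] [SFinite ν] {f : α → β → ℝ}
    (hf : Measurable (Function.uncurry f)) (h0 : ∀ᵐ y ∂ν, ∀ x, 0 ≤ f x y)
    (hx : ∀ x, Integrable (f x) ν) (hy : ∀ᵐ y ∂ν, Integrable (fun x => f x y) μ) :
    ∫ x, ∫ y, f x y ∂ν ∂μ = ∫ y, ∫ x, f x y ∂μ ∂ν := by
  rw [integral_eq_lintegral_of_nonneg_ae, integral_eq_lintegral_of_nonneg_ae]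
  · congr 1
    calc ∫⁻ x, ENNReal.ofReal (∫ y, f x y ∂ν) ∂μ
        = ∫⁻ x, ∫⁻ y, ENNReal.ofReal (f x y) ∂ν ∂μ := lintegral_congr fun x =>
          ofReal_integral_eq_lintegral_ofReal (hx x) (h0.mono fun y hy => hy x)
      _ = ∫⁻ y, ∫⁻ x, ENNReal.ofReal (f x y) ∂μ ∂ν :=
          lintegral_lintegral_swap hf.ennreal_ofReal.aemeasurable
      _ = ∫⁻ y, ENNReal.ofReal (∫ x, f x y ∂μ) ∂ν := lintegral_congr_ae <| by
          filter_upwards [h0, hy] with y h0 hy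
          exact (ofReal_integral_eq_lintegral_ofReal hy (.of_forall h0)).symm
  · exact h0.mono fun y hy => integral_nonneg hy
  · exact hf.stronglyMeasurable.integral_prod_left.aestronglyMeasurable
  · exact .of_forall fun x => integral_nonneg_of_ae (h0.mono fun y hy => hy x)
  · exact hf.stronglyMeasurable.integral_prod_right.aestronglyMeasurable

section Gaussian

variable {ι : Type*} [Fintype ι]

lemma exp_neg_sum_mul_sq (b : ι → ℝ) (x : ι → ℝ) :
    Real.exp (-∑ i, b i * x i ^ 2) = ∏ i, Real.exp (-b i * x i ^ 2) := by
  rw [← Real.exp_sum, ← Finset.sum_neg_distrib]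
  simp only [neg_mul]

lemma integrable_exp_neg_sum_mul_sq {b : ι → ℝ} (hb : ∀ i, 0 < b i) :
    Integrable fun x : EuclideanSpace ℝ ι => Real.exp (-∑ i, b i * x i ^ 2) := by
  have h : Integrable fun x : ι → ℝ => Real.exp (-∑ i, b i * x i ^ 2) := by
    simp only [exp_neg_sum_mul_sq]
    exact Integrable.fintype_prod fun i => integrable_exp_neg_mul_sq (hb i)
  exact ((EuclideanSpace.volume_preserving_symm_measurableEquiv_toLp ι).integrable_comp_emb
    (MeasurableEquiv.measurableEmbedding _)).2 h

lemma integral_exp_neg_sum_mul_sq (b : ι → ℝ) :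
    ∫ x : EuclideanSpace ℝ ι, Real.exp (-∑ i, b i * x i ^ 2) = ∏ i, √(Real.pi / b i) := by
  have h := (EuclideanSpace.volume_preserving_symm_measurableEquiv_toLp ι).integral_comp
    (MeasurableEquiv.measurableEmbedding _) fun x : ι → ℝ => Real.exp (-∑ i, b i * x i ^ 2)
  refine h.trans ?_
  simp only [exp_neg_sum_mul_sq]
  rw [integral_fintype_prod_volume_eq_prod fun i (t : ℝ) => Real.exp (-b i * t ^ 2)]
  simp only [integral_gaussian]

/-- Represent the square root by its `s`-integral and exchange the integrals; for fixed `s` the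
inner integral is a difference of two product Gaussians. -/
lemma integral_sqrt_mul_exp {p : ι → ℝ} (hp : ∀ i, 0 ≤ p i) :
    (∫ x : EuclideanSpace ℝ ι, √(∑ i, p i * x i ^ 2) * Real.exp (-∑ i, x i ^ 2)) * sqrtConst
      = √Real.pi ^ Fintype.card ι *
        ∫ s in Ioi (0 : ℝ), (1 - (√(∏ i, (1 + s * p i)))⁻¹) * s ^ (-3 / 2 : ℝ) := by
  have hq : ∀ x : EuclideanSpace ℝ ι, 0 ≤ ∑ i, p i * x i ^ 2 := fun x =>
    Finset.sum_nonneg fun i _ => mul_nonneg (hp i) (sq_nonneg _)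
  have hint : ∀ q : ℝ, 0 ≤ q → IntegrableOn
      (fun s : ℝ => (1 - Real.exp (-(s * q))) * s ^ (-3 / 2 : ℝ)) (Ioi 0) := fun q hq =>
    integrableOn_mul_rpow_neg_three_halves (C := q) (by fun_prop)
      (fun s hs => one_sub_exp_neg_nonneg (mul_nonneg hs.le hq))
      (fun s _ => by linarith [Real.exp_pos (-(s * q))])
      fun s _ _ => by linarith [Real.add_one_le_exp (-(s * q))]
  set f : EuclideanSpace ℝ ι → ℝ → ℝ := fun x s =>
    (1 - Real.exp (-(s * ∑ i, p i * x i ^ 2))) * s ^ (-3 / 2 : ℝ) * Real.exp (-∑ i, x i ^ 2)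
    with hf
  have hfeq : ∀ s x, f x s = s ^ (-3 / 2 : ℝ) * (Real.exp (-∑ i, (1 : ℝ) * x i ^ 2)
      - Real.exp (-∑ i, (1 + s * p i) * x i ^ 2)) := by
    intro s x
    have : ∑ i, (1 + s * p i) * x i ^ 2 = s * ∑ i, p i * x i ^ 2 + ∑ i, x i ^ 2 := by
      rw [Finset.mul_sum, ← Finset.sum_add_distrib]
      exact Finset.sum_congr rfl fun i _ => by ring
    simp only [hf, this, neg_add, Real.exp_add, one_mul]
    ring
  have hpos : ∀ s : ℝ, 0 < s → ∀ i, 0 < 1 + s * p i := fun s hs i => by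
    have := mul_nonneg hs.le (hp i)
    linarith
  calc _ = ∫ x, ∫ s in Ioi (0 : ℝ), f x s := by
        rw [← integral_mul_const]
        refine integral_congr_ae (.of_forall fun x => ?_)
        simp only [hf]
        rw [integral_mul_const, integral_one_sub_exp_mul (hq x)]
        ring
    _ = ∫ s in Ioi (0 : ℝ), ∫ x, f x s := by
        refine integral_integral_swap_of_nonneg ?_ ?_ ?_ ?_
        · simp only [hf, Function.uncurry_def]
          fun_prop
        · filter_upwards [ae_restrict_mem measurableSet_Ioi] with s hs x
          exact mul_nonneg (mul_nonneg (one_sub_exp_neg_nonneg (mul_nonneg (le_of_lt hs) (hq x)))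
            (Real.rpow_nonneg (le_of_lt hs) _)) (Real.exp_pos _).le
        · exact fun x => (hint _ (hq x)).mul_const _
        · filter_upwards [ae_restrict_mem measurableSet_Ioi] with s hs
          simp only [hfeq]
          exact ((integrable_exp_neg_sum_mul_sq fun _ => one_pos).sub
            (integrable_exp_neg_sum_mul_sq (hpos s hs))).const_mul _
    _ = _ := by
        rw [← integral_const_mul]
        refine setIntegral_congr_fun measurableSet_Ioi fun s hs => ?_
        simp only [hfeq]
        rw [integral_const_mul, integral_sub (integrable_exp_neg_sum_mul_sq fun _ => one_pos)
          (integrable_exp_neg_sum_mul_sq (hpos s hs)), integral_exp_neg_sum_mul_sq,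
          integral_exp_neg_sum_mul_sq]
        simp only [Real.sqrt_div Real.pi_pos.le, Finset.prod_div_distrib, Finset.prod_const,
          Finset.card_univ, div_one]
        rw [Real.sqrt_prod _ fun i _ => (hpos s hs i).le, div_eq_mul_inv]
        ring

end Gaussian

/-! ### Polar coordinates -/

section Polar

variable {E : Type*} [NormedAddCommGroup E] [NormedSpace ℝ E] [MeasurableSpace E] [BorelSpace E]
  [FiniteDimensional ℝ E] [Nontrivial E] (μ : Measure E) [μ.IsAddHaarMeasure]

/-- The radial factor in the Gaussian integral of a positively homogeneous function of degree 1. -/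
noncomputable def radialConst (E : Type*) [NormedAddCommGroup E] [NormedSpace ℝ E] : ℝ :=
  ∫ r : Ioi (0 : ℝ), r.1 * Real.exp (-r.1 ^ 2)
    ∂Measure.volumeIoiPow (Module.finrank ℝ E - 1)

/-- Homogeneity separates the integrand in polar coordinates. -/
lemma integral_mul_exp_neg_norm_sq {f : E → ℝ} (hf : ∀ r : ℝ, 0 < r → ∀ x, f (r • x) = r * f x) :
    ∫ x, f x * Real.exp (-‖x‖ ^ 2) ∂μ
      = (∫ u : sphere (0 : E) 1, f u ∂μ.toSphere) * radialConst E := by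
  calc ∫ x, f x * Real.exp (-‖x‖ ^ 2) ∂μ
      = ∫ x : ({(0)}ᶜ : Set E), f x.1 * Real.exp (-‖x.1‖ ^ 2) ∂(μ.comap (↑)) := by
        rw [integral_subtype_comap (measurableSet_singleton _).compl
          fun x => f x * Real.exp (-‖x‖ ^ 2), restrict_compl_singleton]
    _ = ∫ z, f z.1 * (z.2.1 * Real.exp (-z.2.1 ^ 2))
          ∂μ.toSphere.prod (.volumeIoiPow (Module.finrank ℝ E - 1)) := by
        rw [← μ.measurePreserving_homeomorphUnitSphereProd.integral_comp
          (Homeomorph.measurableEmbedding _)]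
        refine integral_congr_ae (.of_forall fun x => ?_)
        have hx : (0 : ℝ) < ‖x.1‖ := norm_pos_iff.2 x.2
        have : f x.1 = ‖x.1‖ * f (‖x.1‖⁻¹ • x.1) := by
          rw [← hf _ hx, smul_smul, mul_inv_cancel₀ hx.ne', one_smul]
        simp only [homeomorphUnitSphereProd_apply_snd_coe, homeomorphUnitSphereProd_apply_fst_coe]
        rw [this]
        ring
    _ = _ := integral_prod_mul (fun u : sphere (0 : E) 1 => f u)
        fun r : Ioi (0 : ℝ) => r.1 * Real.exp (-r.1 ^ 2)

/-- The volume of a star body in terms of its radial function. -/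
lemma measure_radial_lt {ρ : sphere (0 : E) 1 → ℝ} (hρ : Measurable ρ) (hpos : ∀ u, 0 < ρ u) :
    μ {x : E | ∃ u : sphere (0 : E) 1, ∃ r : ℝ, 0 < r ∧ r < ρ u ∧ x = r • u.1}
      = ∫⁻ u, ENNReal.ofReal (ρ u ^ Module.finrank ℝ E / Module.finrank ℝ E) ∂μ.toSphere := by
  set T : Set (sphere (0 : E) 1 × Ioi (0 : ℝ)) := {z | z.2.1 < ρ z.1} with hT
  have hTm : MeasurableSet T := measurableSet_lt (by fun_prop) (by fun_prop)
  have hset : {x : E | ∃ u : sphere (0 : E) 1, ∃ r : ℝ, 0 < r ∧ r < ρ u ∧ x = r • u.1}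
      = Subtype.val '' (homeomorphUnitSphereProd E ⁻¹' T) := by
    rw [← Homeomorph.image_symm, image_image]
    ext x
    constructor
    · rintro ⟨u, r, h0, h1, rfl⟩
      exact ⟨(u, ⟨r, h0⟩), h1, by simp⟩
    · rintro ⟨⟨u, r⟩, h1, rfl⟩
      exact ⟨u, r, r.2, h1, by simp⟩
  rw [hset, ← comap_subtype_coe_apply (measurableSet_singleton (0 : E)).compl,
    μ.measurePreserving_homeomorphUnitSphereProd.measure_preimage hTm.nullMeasurableSet,
    Measure.prod_apply hTm]
  refine lintegral_congr fun u => ?_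
  have : Prod.mk u ⁻¹' T = Iio ⟨ρ u, hpos u⟩ := rfl
  have hn : 0 < Module.finrank ℝ E := Module.finrank_pos
  rw [this, Measure.volumeIoiPow_apply_Iio, Nat.sub_add_cancel hn, Nat.cast_pred hn,
    sub_add_cancel]

end Polar

/-! ### First variation of the volume of the unit ball -/

/-- The constant `3 ^ n` is crude but inductive, since `n + 2 * 3 ^ n ≤ 3 ^ (n + 1)`. It is the
upper counterpart of Bernoulli's inequality. -/
lemma one_add_pow_le_quadratic (n : ℕ) {y : ℝ} (h0 : 0 ≤ y) (h1 : y ≤ 1) :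
    (1 + y) ^ n ≤ 1 + n * y + 3 ^ n * y ^ 2 := by
  induction n with
  | zero => simpa using sq_nonneg y
  | succ n ih =>
    have hn : (n : ℝ) ≤ 3 ^ n := by
      exact_mod_cast (Nat.lt_pow_self (by norm_num : 1 < 3)).le
    have h3 : y ^ 3 ≤ y ^ 2 := pow_le_pow_of_le_one h0 h1 (by norm_num)
    have hpow : (0 : ℝ) < 3 ^ n := by positivity
    calc (1 + y) ^ (n + 1) = (1 + y) ^ n * (1 + y) := pow_succ _ _
      _ ≤ (1 + n * y + 3 ^ n * y ^ 2) * (1 + y) := by gcongr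
      _ = 1 + (n + 1) * y + n * y ^ 2 + 3 ^ n * y ^ 2 + 3 ^ n * y ^ 3 := by ring
      _ ≤ 1 + (n + 1) * y + 3 ^ n * y ^ 2 + 3 ^ n * y ^ 2 + 3 ^ n * y ^ 2 := by gcongr
      _ = _ := by push_cast; ring

lemma tendsto_div_of_quadratic_bound {f : ℝ → ℝ} {v A C δ : ℝ} (hδ : 0 < δ)
    (hl : ∀ t, 0 < t → t < δ → v + t * A - C * t ^ 2 ≤ f t)
    (hu : ∀ t, 0 < t → t < δ → f t ≤ v + t * A + C * t ^ 2) :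
    Tendsto (fun t => (f t - v) / t) (𝓝[>] 0) (𝓝 A) := by
  have hmem : Ioo (0 : ℝ) δ ∈ 𝓝[>] (0 : ℝ) := Ioo_mem_nhdsGT hδ
  have hlim : ∀ c : ℝ, Tendsto (fun t : ℝ => A + c * t) (𝓝[>] 0) (𝓝 A) := fun c => by
    have : Continuous fun t : ℝ => A + c * t := by fun_prop
    simpa using (this.tendsto 0).mono_left nhdsWithin_le_nhds
  refine tendsto_of_tendsto_of_tendsto_of_le_of_le' (hlim (-C)) (hlim C) ?_ ?_
  · filter_upwards [hmem] with t ht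
    rw [le_div_iff₀ ht.1]
    linarith [hl t ht.1 ht.2]
  · filter_upwards [hmem] with t ht
    rw [div_le_iff₀ ht.1]
    linarith [hu t ht.1 ht.2]

section BallVariation

variable {E : Type*} [NormedAddCommGroup E] [InnerProductSpace ℝ E] {L : Set E} {R t : ℝ}
  {h : sphere (0 : E) 1 → ℝ}

/-- If `x = b + t y` has direction `u`, then `‖x‖ = ⟨b, u⟩ + t ⟨y, u⟩ ≤ 1 + t h(u)`. The extra `t ^
2` makes this strict; the origin has no direction. -/
lemma ball_add_smul_subset_radial
    (hle : ∀ (u : sphere (0 : E) 1), ∀ y ∈ L, inner ℝ y u.1 ≤ h u) (ht : 0 < t) :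
    closedBall (0 : E) 1 + t • L ⊆
      {0} ∪ {x : E | ∃ u : sphere (0 : E) 1, ∃ r : ℝ,
        0 < r ∧ r < 1 + (t * h u + t ^ 2) ∧ x = r • u.1} := by
  intro x hx
  by_cases hx0 : x = 0
  · exact Or.inl hx0
  have hnx : 0 < ‖x‖ := norm_pos_iff.2 hx0
  obtain ⟨b, hb, _, ⟨y, hy, rfl⟩, rfl⟩ := hx
  change 0 < ‖b + t • y‖ at hnx
  have hu1 : ‖‖b + t • y‖⁻¹ • (b + t • y)‖ = 1 := by
    rw [norm_smul, norm_inv, norm_norm, inv_mul_cancel₀ hnx.ne']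
  set u : sphere (0 : E) 1 := ⟨‖b + t • y‖⁻¹ • (b + t • y), mem_sphere_zero_iff_norm.2 hu1⟩ with hu
  refine Or.inr ⟨u, ‖b + t • y‖, hnx, ?_, by rw [hu, smul_inv_smul₀ hnx.ne']⟩
  have hbu : inner ℝ b u.1 ≤ 1 := by
    refine (real_inner_le_norm _ _).trans ?_
    simpa using hb
  have hsum : ‖b + t • y‖ = inner ℝ b u.1 + t * inner ℝ y u.1 := by
    rw [← real_inner_smul_left, ← inner_add_left, hu]
    simp only
    rw [real_inner_smul_right, real_inner_self_eq_norm_sq]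
    field_simp
  have := mul_le_mul_of_nonneg_left (hle u y hy) ht.le
  have := pow_pos ht 2
  linarith

/-- For `r > 1`, subtracting `t y` with `y` a support point of `L` in direction `u` brings `r u`
back into the ball; the sideways part of `y` costs only second order in `t`. -/
lemma radial_subset_ball_add_smul (hR : ∀ y ∈ L, ‖y‖ ≤ R) (h0 : (0 : E) ∈ L)
    (hex : ∀ u : sphere (0 : E) 1, ∃ y ∈ L, inner ℝ y u.1 = h u)
    (ht : 0 < t) (htR : t * R ≤ 1) :
    {x : E | ∃ u : sphere (0 : E) 1, ∃ r : ℝ,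
        0 < r ∧ r < 1 + (t * h u - t ^ 2 * R ^ 2) ∧ x = r • u.1} ⊆
      closedBall (0 : E) 1 + t • L := by
  rintro _ ⟨u, r, hr0, hr, rfl⟩
  have hu : ‖u.1‖ = 1 := by simp
  rcases le_or_gt r 1 with hr1 | hr1
  · exact ⟨r • u.1, by simpa [norm_smul, abs_of_pos hr0] using hr1, 0, ⟨0, h0, by simp⟩, by simp⟩
  obtain ⟨y, hy, hyu⟩ := hex u
  refine ⟨r • u.1 - t • y, ?_, t • y, ⟨y, hy, rfl⟩, by simp⟩
  have hyR := hR y hy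
  have hR0 : 0 ≤ R := (norm_nonneg y).trans hyR
  have hhR : h u ≤ R := by
    rw [← hyu]
    refine (real_inner_le_norm _ _).trans ?_
    rwa [hu, mul_one]
  have key : ‖r • u.1 - t • y‖ ^ 2 = r ^ 2 - 2 * (r * (t * h u)) + t ^ 2 * ‖y‖ ^ 2 := by
    rw [norm_sub_sq_real, norm_smul, norm_smul, real_inner_smul_left, real_inner_smul_right,
      real_inner_comm, hyu, hu, Real.norm_of_nonneg hr0.le, Real.norm_of_nonneg ht.le]
    ring
  rw [mem_closedBall_zero_iff, ← sq_le_one_iff₀ (norm_nonneg _), key]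
  have hy2 : t ^ 2 * ‖y‖ ^ 2 ≤ t ^ 2 * R ^ 2 := by gcongr
  have hw0 : 0 ≤ t ^ 2 * R ^ 2 := by positivity
  have hw1 : t ^ 2 * R ^ 2 ≤ 1 := by
    rw [← mul_pow]; exact pow_le_one₀ (by positivity) htR
  have hth : t * h u ≤ 1 := (mul_le_mul_of_nonneg_left hhR ht.le).trans htR
  -- With `w = t² R²`, the bound is convex in `r`, so the ends of `[1, 1 + t h - w]` suffice: at `1`
  -- use `w ≤ t h` (the interval is nonempty), at the other end `w² ≤ w`.
  nlinarith

variable [MeasurableSpace E] [BorelSpace E] [FiniteDimensional ℝ E] [Nontrivial E]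
  (μ : Measure E) [μ.IsAddHaarMeasure]

lemma measureReal_radial_lt {ρ : sphere (0 : E) 1 → ℝ} (hρ : Measurable ρ)
    (hpos : ∀ u, 0 < ρ u) :
    μ.real {x : E | ∃ u : sphere (0 : E) 1, ∃ r : ℝ, 0 < r ∧ r < ρ u ∧ x = r • u.1}
      = ∫ u, ρ u ^ Module.finrank ℝ E / Module.finrank ℝ E ∂μ.toSphere := by
  rw [measureReal_def, measure_radial_lt μ hρ hpos, integral_eq_lintegral_of_nonneg_ae]
  · exact .of_forall fun u => div_nonneg (pow_nonneg (hpos u).le _) (Nat.cast_nonneg _)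
  · fun_prop

/-- The right derivative at `0` of `t ↦ Vol (B + t L)` is the integral over the sphere of the
support function of `L`. -/
theorem tendsto_measureReal_ball_add_smul (hR : ∀ y ∈ L, ‖y‖ ≤ R) (h0 : (0 : E) ∈ L)
    (hle : ∀ (u : sphere (0 : E) 1), ∀ y ∈ L, inner ℝ y u.1 ≤ h u)
    (hex : ∀ u : sphere (0 : E) 1, ∃ y ∈ L, inner ℝ y u.1 = h u) (hh : Measurable h) :
    Tendsto (fun t : ℝ =>
        (μ.real (closedBall (0 : E) 1 + t • L) - μ.real (closedBall (0 : E) 1)) / t)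
      (𝓝[>] 0) (𝓝 (∫ u, h u ∂μ.toSphere)) := by
  have hR0 : 0 ≤ R := (norm_nonneg (0 : E)).trans (hR 0 h0)
  have hh0 : ∀ u, 0 ≤ h u := fun u => by simpa using hle u 0 h0
  have hhR : ∀ u, h u ≤ R := fun u => by
    obtain ⟨y, hy, hyu⟩ := hex u
    rw [← hyu]
    refine (real_inner_le_norm _ _).trans ?_
    simpa using hR y hy
  set n := Module.finrank ℝ E with hn
  have hn0 : (0 : ℝ) < n := Nat.cast_pos.2 Module.finrank_pos
  have hbdd : ∀ (g : sphere (0 : E) 1 → ℝ) (c : ℝ), Measurable g → (∀ u, |g u| ≤ c) →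
      Integrable g μ.toSphere := fun g c hg hc =>
    Integrable.of_bound hg.aestronglyMeasurable c (.of_forall hc)
  have ih : Integrable h μ.toSphere :=
    hbdd h R hh fun u => by rw [abs_of_nonneg (hh0 u)]; exact hhR u
  set σ := μ.toSphere.real univ with hσ
  have hball : μ.real (closedBall (0 : E) 1) = σ / n := by
    rw [hσ, Measure.toSphere_real_apply_univ, measureReal_def, measureReal_def,
      Measure.addHaar_closedBall_eq_addHaar_ball, ← hn]
    field_simp
  have hquad : ∀ c d : ℝ, ∫ u, (1 / (n : ℝ) + c * h u + d) ∂μ.toSphere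
      = σ / n + c * ∫ u, h u ∂μ.toSphere + d * σ := fun c d => by
    have i := (integrable_const (1 / (n : ℝ)) (μ := μ.toSphere)).add (ih.const_mul c)
    rw [integral_add (by exact i) (integrable_const _),
      integral_add (integrable_const _) (ih.const_mul c), integral_const_mul, integral_const,
      integral_const, smul_eq_mul, smul_eq_mul]
    ring
  -- The term `R ^ 2` pays for the lower bound (inner radial set and Bernoulli), the rest for the
  -- upper one (outer radial set and quadratic remainder).
  set C := (R ^ 2 + 1 + 3 ^ n / n * (R + 1) ^ 2) * σ with hC
  have hσ0 : 0 ≤ σ := measureReal_nonneg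
  -- For `t` below this threshold, `t R ≤ 1` and `t h + t² ≤ t (R + 1) ≤ 1`.
  have hδ : 0 < 1 / (R + 1) := by positivity
  have hfin : ∀ {t : ℝ}, μ (closedBall (0 : E) 1 + t • L) ≠ ⊤ := fun {t} =>
    (isBounded_closedBall.add ((isBounded_iff_forall_norm_le.2 ⟨R, hR⟩).smul₀ t)).measure_lt_top.ne
  refine tendsto_div_of_quadratic_bound (C := C) hδ ?_ ?_
  · intro t ht0 ht
    rw [lt_div_iff₀ (by positivity)] at ht
    have htR : t * R ≤ 1 := by nlinarith
    have hw1 : t ^ 2 * R ^ 2 < 1 := by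
      rw [← mul_pow]
      exact pow_lt_one₀ (by positivity) (by nlinarith) two_ne_zero
    have hth0 : ∀ u, 0 ≤ t * h u := fun u => mul_nonneg ht0.le (hh0 u)
    have hth1 : ∀ u, t * h u ≤ 1 := fun u =>
      (mul_le_mul_of_nonneg_left (hhR u) ht0.le).trans htR
    have hpos : ∀ u, 0 < 1 + (t * h u - t ^ 2 * R ^ 2) := fun u => by linarith [hth0 u]
    have hm : Measurable fun u => 1 + (t * h u - t ^ 2 * R ^ 2) := by fun_prop
    have hmono := measureReal_mono (μ := μ) (radial_subset_ball_add_smul hR h0 hex ht0 htR) hfin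
    rw [measureReal_radial_lt μ hm hpos, ← hn] at hmono
    refine le_trans ?_ hmono
    have hi : Integrable (fun u => (1 + (t * h u - t ^ 2 * R ^ 2)) ^ n / n) μ.toSphere := by
      refine hbdd _ (2 ^ n / n) (by fun_prop) fun u => ?_
      rw [abs_of_nonneg (by have := hpos u; positivity)]
      gcongr
      · exact (hpos u).le
      · linarith [hth1 u, sq_nonneg (t * R), mul_pow t R 2]
    have hj : Integrable (fun u => 1 / (n : ℝ) + t * h u + -(t ^ 2 * R ^ 2)) μ.toSphere :=
      ((integrable_const _).add (ih.const_mul t)).add (integrable_const _)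
    calc μ.real (closedBall (0 : E) 1) + t * ∫ u, h u ∂μ.toSphere - C * t ^ 2
        ≤ ∫ u, (1 / (n : ℝ) + t * h u + -(t ^ 2 * R ^ 2)) ∂μ.toSphere := by
          rw [hquad, hball]
          have : 0 ≤ (1 + 3 ^ n / n * (R + 1) ^ 2) * σ * t ^ 2 := by positivity
          rw [hC]
          linarith
      _ ≤ _ := by
          refine integral_mono hj hi fun u => ?_
          have := one_add_mul_le_pow (a := t * h u - t ^ 2 * R ^ 2) (by linarith [hth0 u]) n
          rw [le_div_iff₀ hn0]
          refine le_trans (le_of_eq ?_) this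
          field_simp
          ring
  · intro t ht0 ht
    rw [lt_div_iff₀ (by positivity)] at ht
    have hy0 : ∀ u, 0 ≤ t * h u + t ^ 2 := fun u => by have := hh0 u; positivity
    have hyt : ∀ u, t * h u + t ^ 2 ≤ t * (R + 1) := fun u => by
      have h1 : t * h u ≤ t * R := mul_le_mul_of_nonneg_left (hhR u) ht0.le
      have h2 : t ^ 2 ≤ t := by nlinarith
      linarith
    have hy1 : ∀ u, t * h u + t ^ 2 ≤ 1 := fun u => (hyt u).trans ht.le
    have hm : Measurable fun u => 1 + (t * h u + t ^ 2) := by fun_prop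
    have hpos : ∀ u, 0 < 1 + (t * h u + t ^ 2) := fun u => by linarith [hy0 u]
    have hmono := measureReal_mono (μ := μ) (ball_add_smul_subset_radial hle ht0) <| by
      refine ne_of_lt (measure_union_lt_top (by simp)
        ((isBounded_iff_forall_norm_le.2 ⟨2, ?_⟩).measure_lt_top))
      rintro _ ⟨u, r, hr0, hr, rfl⟩
      rw [norm_smul, norm_eq_of_mem_sphere, mul_one, Real.norm_of_nonneg hr0.le]
      linarith [hy1 u]
    replace hmono := hmono.trans (measureReal_union_le _ _)
    rw [measureReal_radial_lt μ hm hpos, ← hn, measureReal_def μ {0}, measure_singleton,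
      ENNReal.toReal_zero, zero_add] at hmono
    refine hmono.trans ?_
    have hi : Integrable (fun u => (1 + (t * h u + t ^ 2)) ^ n / n) μ.toSphere := by
      refine hbdd _ (2 ^ n / n) (by fun_prop) fun u => ?_
      rw [abs_of_nonneg (by have := hpos u; positivity)]
      gcongr
      · exact (hpos u).le
      · linarith [hy1 u]
    set d : ℝ := t ^ 2 + 3 ^ n / n * (t * (R + 1)) ^ 2 with hd
    have hj : Integrable (fun u => 1 / (n : ℝ) + t * h u + d) μ.toSphere :=
      ((integrable_const _).add (ih.const_mul t)).add (integrable_const _)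
    calc _ ≤ ∫ u, (1 / (n : ℝ) + t * h u + d) ∂μ.toSphere := by
          refine integral_mono hi hj fun u => ?_
          have h1 := one_add_pow_le_quadratic n (hy0 u) (hy1 u)
          have h2 : (t * h u + t ^ 2) ^ 2 ≤ (t * (R + 1)) ^ 2 :=
            pow_le_pow_left₀ (hy0 u) (hyt u) 2
          have h3 : (3 : ℝ) ^ n * (t * h u + t ^ 2) ^ 2 ≤ 3 ^ n * (t * (R + 1)) ^ 2 := by gcongr
          simp only
          rw [div_le_iff₀ hn0]
          refine (h1.trans (add_le_add_right h3 _)).trans (le_of_eq ?_)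
          rw [hd]
          field_simp
          ring
      _ ≤ _ := by
          rw [hquad, hball]
          have : 0 ≤ R ^ 2 * σ * t ^ 2 := by positivity
          rw [hC, hd]
          linarith

end BallVariation

/-! ### Diagonal maps -/

section Diagonal

variable {n : ℕ}

/-- The diagonal linear map of `ℝⁿ` with diagonal entries `m i`. -/
def diagMap (m : Fin n → ℝ) : EuclideanSpace ℝ (Fin n) →ₗ[ℝ] EuclideanSpace ℝ (Fin n) where
  toFun x := WithLp.toLp 2 fun i => m i * x i
  map_add' x y := by ext i; simp [mul_add]
  map_smul' c x := by ext i; simp [mul_left_comm]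

@[simp]
lemma diagMap_apply (m : Fin n → ℝ) (x : EuclideanSpace ℝ (Fin n)) (i : Fin n) :
    diagMap m x i = m i * x i := rfl

lemma continuous_diagMap (m : Fin n → ℝ) : Continuous (diagMap m) :=
  LinearMap.continuous_of_finiteDimensional _

lemma inner_diagMap (m : Fin n → ℝ) (x y : EuclideanSpace ℝ (Fin n)) :
    inner ℝ (diagMap m x) y = inner ℝ x (diagMap m y) := by
  simp only [PiLp.inner_apply, diagMap_apply, RCLike.inner_apply, conj_trivial]
  exact Finset.sum_congr rfl fun i _ => by ring

lemma diagMap_inv_apply {m : Fin n → ℝ} (hm : ∀ i, 0 < m i) (x : EuclideanSpace ℝ (Fin n)) :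
    diagMap m (diagMap m⁻¹ x) = x := by
  ext i
  simp [(hm i).ne']

lemma norm_diagMap (m : Fin n → ℝ) (x : EuclideanSpace ℝ (Fin n)) :
    ‖diagMap m x‖ = √(∑ i, m i ^ 2 * x i ^ 2) := by
  simp [EuclideanSpace.norm_eq, mul_pow]

lemma norm_diagMap_smul (m : Fin n → ℝ) (r : ℝ) (hr : 0 < r) (x : EuclideanSpace ℝ (Fin n)) :
    ‖diagMap m (r • x)‖ = r * ‖diagMap m x‖ := by
  rw [map_smul, norm_smul, Real.norm_of_nonneg hr.le]

lemma det_diagMap (m : Fin n → ℝ) : LinearMap.det (diagMap m) = ∏ i, m i := by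
  have h : diagMap m = ((WithLp.linearEquiv 2 ℝ (Fin n → ℝ)).symm : _ →ₗ[ℝ] _) ∘ₗ
      Matrix.toLin' (Matrix.diagonal m) ∘ₗ
      ((WithLp.linearEquiv 2 ℝ (Fin n → ℝ)).symm.symm : _ →ₗ[ℝ] _) := by
    ext x i
    simp [Matrix.mulVec_diagonal]
  rw [h, LinearMap.det_conj, LinearMap.det_toLin', Matrix.det_diagonal]

lemma standardEllipsoid_eq_image {a : Fin n → ℝ} (ha : ∀ i, 0 < a i) :
    standardEllipsoid a = diagMap a '' closedBall 0 1 := by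
  ext x
  constructor
  · intro hx
    refine ⟨diagMap a⁻¹ x, ?_, diagMap_inv_apply ha x⟩
    rw [mem_closedBall_zero_iff, norm_diagMap, Real.sqrt_le_one]
    simpa [standardEllipsoid, div_eq_inv_mul] using hx
  · rintro ⟨y, hy, rfl⟩
    have : ‖y‖ ^ 2 ≤ 1 := pow_le_one₀ (norm_nonneg _) (mem_closedBall_zero_iff.1 hy)
    rw [EuclideanSpace.real_norm_sq_eq] at this
    refine le_trans (le_of_eq (Finset.sum_congr rfl fun i _ => ?_)) this
    have := (ha i).ne'
    simp only [diagMap_apply]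
    field_simp

lemma volume_diagMap_image {m : Fin n → ℝ} (hm : ∀ i, 0 < m i)
    (X : Set (EuclideanSpace ℝ (Fin n))) :
    volume (diagMap m '' X) = ENNReal.ofReal (∏ i, m i) * volume X := by
  rw [Measure.addHaar_image_linearMap, det_diagMap,
    abs_of_pos (Finset.prod_pos fun i _ => hm i)]

end Diagonal

/-! ### Isometries -/

section Isometry

variable {E : Type*} [NormedAddCommGroup E] [InnerProductSpace ℝ E] (φ : E ≃ᵢ E)

lemma IsometryEquiv.apply_eq_linear_add (x : E) :
    φ x = φ.toRealLinearIsometryEquiv x + φ 0 := by simp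

lemma IsometryEquiv.image_add_closedBall (X : Set E) (t : ℝ) :
    φ '' X + t • closedBall (0 : E) 1 = φ '' (X + t • closedBall (0 : E) 1) := by
  have hφ : (φ : E → E) = fun x => φ.toRealLinearIsometryEquiv x + φ 0 :=
    funext φ.apply_eq_linear_add
  have hB : φ.toRealLinearIsometryEquiv '' (t • closedBall (0 : E) 1) = t • closedBall (0 : E) 1 := by
    rw [image_smul_set, LinearIsometryEquiv.image_closedBall, map_zero]
  have himage : ∀ Y : Set E, φ '' Y = φ.toRealLinearIsometryEquiv '' Y + {φ 0} := fun Y => by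
    rw [add_singleton, image_image, ← hφ]
  rw [himage, himage, image_add, hB, add_right_comm]

lemma IsometryEquiv.volume_image [MeasurableSpace E] [BorelSpace E] [FiniteDimensional ℝ E]
    (X : Set E) : volume (φ '' X) = volume X := by
  have hφ : (φ : E → E) = (fun y => y + φ 0) ∘ φ.toRealLinearIsometryEquiv :=
    funext φ.apply_eq_linear_add
  rw [hφ, image_comp, image_add_right, measure_preimage_add_right,
    LinearIsometryEquiv.image_eq_preimage_symm,
    (LinearIsometryEquiv.measurePreserving _).measure_preimage_emb
      (Homeomorph.measurableEmbedding (LinearIsometryEquiv.toHomeomorph _))]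

lemma isGreatest_inner_closedBall (v : E) :
    IsGreatest ((fun y => inner ℝ y v) '' closedBall 0 1) ‖v‖ := by
  constructor
  · by_cases hv : v = 0
    · exact ⟨0, by simp, by simp [hv]⟩
    · have : ‖v‖ ≠ 0 := norm_ne_zero_iff.2 hv
      refine ⟨‖v‖⁻¹ • v, by simp [norm_smul, this], ?_⟩
      simp only [real_inner_smul_left, real_inner_self_eq_norm_sq]
      field_simp
  · rintro _ ⟨y, hy, rfl⟩
    exact (real_inner_le_norm _ _).trans
      (mul_le_of_le_one_left (norm_nonneg _) (mem_closedBall_zero_iff.1 hy))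

lemma isLeast_inner_closedBall (v : E) :
    IsLeast ((fun y => inner ℝ y v) '' closedBall 0 1) (-‖v‖) := by
  obtain ⟨⟨y, hy, hyv⟩, hub⟩ := isGreatest_inner_closedBall v
  refine ⟨⟨-y, by simpa using hy, by simpa using hyv⟩, ?_⟩
  rintro _ ⟨z, hz, rfl⟩
  have := hub ⟨-z, by simpa using hz, rfl⟩
  simp only [inner_neg_left] at this
  linarith

end Isometry

/-! ### Surface area and mean width of an ellipsoid -/

section Ellipsoid

variable {n : ℕ}

/-- The integral of the Euclidean norm of `(m i * u i)` over the unit sphere. -/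
noncomputable def sphereIntegral (m : Fin n → ℝ) : ℝ :=
  ∫ u : sphere (0 : EuclideanSpace ℝ (Fin n)) 1, ‖diagMap m u‖
    ∂(volume : Measure (EuclideanSpace ℝ (Fin n))).toSphere

lemma volume_ellipsoid {a : Fin n → ℝ} (ha : ∀ i, 0 < a i)
    (φ : EuclideanSpace ℝ (Fin n) ≃ᵢ EuclideanSpace ℝ (Fin n)) :
    volume (φ '' standardEllipsoid a) =
      ENNReal.ofReal (∏ i, a i) * volume (closedBall (0 : EuclideanSpace ℝ (Fin n)) 1) := by
  rw [φ.volume_image, standardEllipsoid_eq_image ha, volume_diagMap_image ha]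

lemma width_ellipsoid {a : Fin n → ℝ} (ha : ∀ i, 0 < a i)
    (φ : EuclideanSpace ℝ (Fin n) ≃ᵢ EuclideanSpace ℝ (Fin n)) (u : EuclideanSpace ℝ (Fin n)) :
    width (φ '' standardEllipsoid a) u
      = 2 * ‖diagMap a (φ.toRealLinearIsometryEquiv.symm u)‖ := by
  set v := diagMap a (φ.toRealLinearIsometryEquiv.symm u)
  set c : ℝ := inner ℝ (φ 0) u
  have himage : (fun x => inner ℝ x u) '' (φ '' standardEllipsoid a)
      = (OrderIso.addRight c) '' ((fun y => inner ℝ y v) '' closedBall 0 1) := by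
    rw [standardEllipsoid_eq_image ha, image_image, image_image, image_image]
    refine image_congr fun y _ => ?_
    rw [φ.apply_eq_linear_add, inner_add_left, OrderIso.addRight_apply, ← inner_diagMap,
      LinearIsometryEquiv.inner_map_eq_flip]
  rw [width, himage,
    ((OrderIso.addRight c).monotone.map_isGreatest (isGreatest_inner_closedBall v)).csSup_eq,
    ((OrderIso.addRight c).monotone.map_isLeast (isLeast_inner_closedBall v)).csInf_eq]
  simp only [OrderIso.addRight_apply]
  ring

variable [Nontrivial (EuclideanSpace ℝ (Fin n))]

/-- Read off from the polar formula for `f = ‖·‖`, whose Gaussian integral is positive; no explicit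
value is needed. -/
lemma radialConst_pos : 0 < radialConst (EuclideanSpace ℝ (Fin n)) := by
  set E := EuclideanSpace ℝ (Fin n)
  obtain ⟨x₀, hx₀⟩ := exists_ne (0 : E)
  have hi : Integrable fun x : E => ‖x‖ * Real.exp (-‖x‖ ^ 2) := by
    refine (integrable_exp_neg_sum_mul_sq (ι := Fin n) (b := fun _ => 1 / 2)
      fun _ => by norm_num).mono' (by fun_prop) (.of_forall fun x => ?_)
    rw [Real.norm_of_nonneg (by positivity), ← Finset.mul_sum, ← EuclideanSpace.real_norm_sq_eq]
    have h1 : ‖x‖ ≤ Real.exp (1 / 2 * ‖x‖ ^ 2) := by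
      have := Real.add_one_le_exp (1 / 2 * ‖x‖ ^ 2)
      nlinarith [sq_nonneg (‖x‖ - 1)]
    calc ‖x‖ * Real.exp (-‖x‖ ^ 2)
        ≤ Real.exp (1 / 2 * ‖x‖ ^ 2) * Real.exp (-‖x‖ ^ 2) := by gcongr
      _ = _ := by rw [← Real.exp_add]; ring_nf
  have hpos : 0 < ∫ x : E, ‖x‖ * Real.exp (-‖x‖ ^ 2) :=
    integral_pos_of_integrable_nonneg_nonzero (x := x₀) (by fun_prop) hi
      (fun x => by positivity) (by positivity)
  rw [integral_mul_exp_neg_norm_sq volume fun r hr x => by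
    rw [norm_smul, Real.norm_of_nonneg hr.le]] at hpos
  exact pos_of_mul_pos_right hpos (integral_nonneg fun u => norm_nonneg _)

/-- Rotation invariance is inherited from Lebesgue measure through the Gaussian integral, after
cancelling the radial constant. -/
lemma integral_sphere_comp_linearIsometryEquiv {f : EuclideanSpace ℝ (Fin n) → ℝ}
    (hf : ∀ r : ℝ, 0 < r → ∀ x, f (r • x) = r * f x)
    (L : EuclideanSpace ℝ (Fin n) ≃ₗᵢ[ℝ] EuclideanSpace ℝ (Fin n)) :
    ∫ u : sphere (0 : EuclideanSpace ℝ (Fin n)) 1, f (L u)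
        ∂(volume : Measure (EuclideanSpace ℝ (Fin n))).toSphere
      = ∫ u : sphere (0 : EuclideanSpace ℝ (Fin n)) 1, f u
        ∂(volume : Measure (EuclideanSpace ℝ (Fin n))).toSphere := by
  refine mul_right_cancel₀ (radialConst_pos (n := n)).ne' ?_
  rw [← integral_mul_exp_neg_norm_sq volume hf,
    ← integral_mul_exp_neg_norm_sq volume (f := fun x => f (L x)) fun r hr x => by
      rw [map_smul, hf r hr]]
  simpa only [LinearIsometryEquiv.norm_map] using
    L.measurePreserving.integral_comp L.toHomeomorph.measurableEmbedding
      fun x => f x * Real.exp (-‖x‖ ^ 2)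

lemma meanWidth_ellipsoid {a : Fin n → ℝ} (ha : ∀ i, 0 < a i)
    (φ : EuclideanSpace ℝ (Fin n) ≃ᵢ EuclideanSpace ℝ (Fin n)) :
    meanWidth (φ '' standardEllipsoid a)
      = ((volume : Measure (EuclideanSpace ℝ (Fin n))).toSphere.real univ)⁻¹ *
        (2 * sphereIntegral a) := by
  rw [meanWidth, average_eq, smul_eq_mul, sphereIntegral]
  simp only [width_ellipsoid ha]
  rw [integral_const_mul,
    integral_sphere_comp_linearIsometryEquiv (f := fun x => ‖diagMap a x‖) (norm_diagMap_smul a)]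

lemma surfaceArea_ellipsoid {a : Fin n → ℝ} (ha : ∀ i, 0 < a i)
    (φ : EuclideanSpace ℝ (Fin n) ≃ᵢ EuclideanSpace ℝ (Fin n)) :
    surfaceArea (φ '' standardEllipsoid a) = (∏ i, a i) * sphereIntegral a⁻¹ := by
  set B := closedBall (0 : EuclideanSpace ℝ (Fin n)) 1
  set L := diagMap a⁻¹ '' B
  have hvol : ∀ X, volume.real (diagMap a '' X) = (∏ i, a i) * volume.real X := fun X => by
    rw [measureReal_def, volume_diagMap_image ha, ENNReal.toReal_mul,
      ENNReal.toReal_ofReal (Finset.prod_nonneg fun i _ => (ha i).le), measureReal_def]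
  have hadd : ∀ t : ℝ, volume.real (φ '' standardEllipsoid a + t • B)
      = (∏ i, a i) * volume.real (B + t • L) := fun t => by
    have hL : diagMap a '' L = B := by
      simp only [L, image_image, diagMap_inv_apply ha, image_id']
    rw [φ.image_add_closedBall, measureReal_def, φ.volume_image, ← measureReal_def,
      standardEllipsoid_eq_image ha, ← hvol, image_add, image_smul_set, hL]
  have h0 : volume.real (φ '' standardEllipsoid a) = (∏ i, a i) * volume.real B := by
    rw [measureReal_def, φ.volume_image, standardEllipsoid_eq_image ha, ← measureReal_def, hvol]
  have hbdd : Bornology.IsBounded L :=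
    ((isCompact_closedBall _ _).image (continuous_diagMap _)).isBounded
  obtain ⟨R, hR⟩ := isBounded_iff_forall_norm_le.1 hbdd
  have key := tendsto_measureReal_ball_add_smul volume (L := L) (R := R)
    (h := fun u => ‖diagMap a⁻¹ u.1‖) hR ⟨0, by simp [B], map_zero _⟩
    (by
      rintro u _ ⟨y, hy, rfl⟩
      rw [inner_diagMap]
      exact (isGreatest_inner_closedBall _).2 ⟨y, hy, rfl⟩)
    (fun u => by
      obtain ⟨y, hy, h⟩ := (isGreatest_inner_closedBall (diagMap a⁻¹ u.1)).1
      exact ⟨_, ⟨y, hy, rfl⟩, by rw [inner_diagMap]; exact h⟩)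
    ((continuous_diagMap _).comp continuous_subtype_val).norm.measurable
  -- The quotient for `A B + t B` is `det A` times that for `B + t A⁻¹ B`; its convergence makes
  -- `limUnder` a genuine limit.
  refine Tendsto.limUnder_eq ((key.const_mul (∏ i, a i)).congr fun t => ?_)
  rw [hadd, h0]
  ring

lemma sphereIntegral_eq (m : Fin n → ℝ) :
    sphereIntegral m * (radialConst (EuclideanSpace ℝ (Fin n)) * sqrtConst)
      = √Real.pi ^ n * ∫ s in Ioi (0 : ℝ),
        (1 - (√(∏ i, (1 + s * m i ^ 2)))⁻¹) * s ^ (-3 / 2 : ℝ) := by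
  have h := integral_sqrt_mul_exp (p := fun i => m i ^ 2) fun i => sq_nonneg _
  rw [Fintype.card_fin] at h
  rw [← h, ← mul_assoc, sphereIntegral,
    ← integral_mul_exp_neg_norm_sq volume (f := fun x => ‖diagMap m x‖) (norm_diagMap_smul m)]
  simp only [norm_diagMap, EuclideanSpace.real_norm_sq_eq]

end Ellipsoid

/-! ### Three dimensions -/

lemma prod_one_add_mul_fin_three (p : Fin 3 → ℝ) (s : ℝ) :
    ∏ i, (1 + s * p i) = 1 + (p 0 + p 1 + p 2) * s + (p 0 * p 1 + p 0 * p 2 + p 1 * p 2) * s ^ 2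
      + (p 0 * p 1 * p 2) * s ^ 3 := by
  rw [Fin.prod_univ_three]
  ring

lemma cubicIntegral_eq_of_sphereIntegral_eq {m m' : Fin 3 → ℝ}
    (h : sphereIntegral m = sphereIntegral m') :
    cubicIntegral (m 0 ^ 2 + m 1 ^ 2 + m 2 ^ 2)
        (m 0 ^ 2 * m 1 ^ 2 + m 0 ^ 2 * m 2 ^ 2 + m 1 ^ 2 * m 2 ^ 2) (m 0 ^ 2 * m 1 ^ 2 * m 2 ^ 2)
      = cubicIntegral (m' 0 ^ 2 + m' 1 ^ 2 + m' 2 ^ 2)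
        (m' 0 ^ 2 * m' 1 ^ 2 + m' 0 ^ 2 * m' 2 ^ 2 + m' 1 ^ 2 * m' 2 ^ 2)
        (m' 0 ^ 2 * m' 1 ^ 2 * m' 2 ^ 2) := by
  have key := sphereIntegral_eq m
  rw [h, sphereIntegral_eq m'] at key
  simp only [prod_one_add_mul_fin_three fun i => m i ^ 2,
    prod_one_add_mul_fin_three fun i => m' i ^ 2] at key
  exact (mul_left_cancel₀ (pow_pos (Real.sqrt_pos.2 Real.pi_pos) 3).ne' key).symm

lemma eq_or_eq_of_add_eq_of_mul_eq {x y u v : ℝ} (hs : x + y = u + v) (hp : x * y = u * v) :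
    x = u ∧ y = v ∨ x = v ∧ y = u := by
  have : (x - u) * (x - v) = 0 := by linear_combination x * hs - hp
  rcases mul_eq_zero.1 this with h | h
  · exact Or.inl ⟨by linarith, by linarith⟩
  · exact Or.inr ⟨by linarith, by linarith⟩

/-- By Vieta `p 0` is a root of `∏ (X - q i)`; cancelling it leaves two pairs with equal sum and
product. -/
lemma exists_perm_of_symmetric_eq {p q : Fin 3 → ℝ} (hp : ∀ i, 0 < p i)
    (h₁ : p 0 + p 1 + p 2 = q 0 + q 1 + q 2)
    (h₂ : p 0 * p 1 + p 0 * p 2 + p 1 * p 2 = q 0 * q 1 + q 0 * q 2 + q 1 * q 2)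
    (h₃ : p 0 * p 1 * p 2 = q 0 * q 1 * q 2) :
    ∃ σ : Equiv.Perm (Fin 3), ∀ i, p i = q (σ i) := by
  have hroot : (p 0 - q 0) * ((p 0 - q 1) * (p 0 - q 2)) = 0 := by
    linear_combination p 0 ^ 2 * h₁ - p 0 * h₂ + h₃
  have hrest : ∀ y z : ℝ, p 0 + y + z = q 0 + q 1 + q 2 → p 0 * y * z = q 0 * q 1 * q 2 →
      p 1 = y ∧ p 2 = z ∨ p 1 = z ∧ p 2 = y := fun y z hs hm =>
    eq_or_eq_of_add_eq_of_mul_eq (by linarith) <| mul_left_cancel₀ (hp 0).ne' <| by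
      rw [← mul_assoc, h₃, ← hm, mul_assoc]
  have hperm : ∀ f : Fin 3 → Fin 3, Function.Bijective f → p 0 = q (f 0) → p 1 = q (f 1) →
      p 2 = q (f 2) → ∃ σ : Equiv.Perm (Fin 3), ∀ i, p i = q (σ i) := fun f hf e₀ e₁ e₂ =>
    ⟨Equiv.ofBijective f hf, Fin.forall_fin_succ.2 ⟨e₀, Fin.forall_fin_two.2 ⟨e₁, e₂⟩⟩⟩
  rcases mul_eq_zero.1 hroot with h | h
  · have h := sub_eq_zero.1 h
    rcases hrest (q 1) (q 2) (by rw [h]) (by rw [h]) with ⟨h', h''⟩ | ⟨h', h''⟩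
    · exact hperm ![0, 1, 2] (by decide) h h' h''
    · exact hperm ![0, 2, 1] (by decide) h h' h''
  rcases mul_eq_zero.1 h with h | h
  · have h := sub_eq_zero.1 h
    rcases hrest (q 0) (q 2) (by rw [h]; ring) (by rw [h]; ring) with ⟨h', h''⟩ | ⟨h', h''⟩
    · exact hperm ![1, 0, 2] (by decide) h h' h''
    · exact hperm ![1, 2, 0] (by decide) h h' h''
  · have h := sub_eq_zero.1 h
    rcases hrest (q 0) (q 1) (by rw [h]; ring) (by rw [h]; ring) with ⟨h', h''⟩ | ⟨h', h''⟩
    · exact hperm ![2, 0, 1] (by decide) h h' h''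
    · exact hperm ![2, 1, 0] (by decide) h h' h''

/-- Standard ellipsoids whose semiaxes agree up to a permutation are congruent. -/
lemma standardEllipsoid_comp_perm {n : ℕ} (a : Fin n → ℝ) (σ : Equiv.Perm (Fin n)) :
    LinearIsometryEquiv.piLpCongrLeft 2 ℝ ℝ σ '' standardEllipsoid (a ∘ σ)
      = standardEllipsoid a := by
  rw [LinearIsometryEquiv.image_eq_preimage_symm]
  ext x
  simp only [standardEllipsoid, mem_preimage, mem_ofPred_eq, Function.comp_apply,
    LinearIsometryEquiv.piLpCongrLeft_symm]
  rw [← Equiv.sum_comp σ fun i => x i ^ 2 / a i ^ 2]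
  rfl

theorem theorem1 (E₁ E₂ : Set (EuclideanSpace ℝ (Fin 3)))
    (h₁ : IsEllipsoid E₁) (h₂ : IsEllipsoid E₂)
    (hvolume : volume E₁ = volume E₂)
    (hsurface : surfaceArea E₁ = surfaceArea E₂)
    (hwidth : meanWidth E₁ = meanWidth E₂) :
    AreCongruent E₁ E₂ := by
  obtain ⟨a, φ, ha, rfl⟩ := h₁
  obtain ⟨b, ψ, hb, rfl⟩ := h₂
  have hprod : ∏ i, a i = ∏ i, b i := by
    rw [volume_ellipsoid ha, volume_ellipsoid hb] at hvolume
    have hball := measure_closedBall_pos (volume : Measure (EuclideanSpace ℝ (Fin 3))) 0 one_pos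
    rwa [ENNReal.mul_left_inj hball.ne' measure_closedBall_lt_top.ne,
      ENNReal.ofReal_eq_ofReal_iff (Finset.prod_nonneg fun i _ => (ha i).le)
        (Finset.prod_nonneg fun i _ => (hb i).le)] at hvolume
  have hI : sphereIntegral a = sphereIntegral b := by
    rw [meanWidth_ellipsoid ha, meanWidth_ellipsoid hb] at hwidth
    have hσ : ((volume : Measure (EuclideanSpace ℝ (Fin 3))).toSphere.real univ)⁻¹ ≠ 0 :=
      inv_ne_zero <| (measureReal_ne_zero_iff).2 <|
        Measure.measure_univ_ne_zero.2 (Measure.toSphere_ne_zero _)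
    exact mul_left_cancel₀ two_ne_zero (mul_left_cancel₀ hσ hwidth)
  have hJ : sphereIntegral a⁻¹ = sphereIntegral b⁻¹ := by
    rw [surfaceArea_ellipsoid ha, surfaceArea_ellipsoid hb, hprod] at hsurface
    exact mul_left_cancel₀ (Finset.prod_pos fun i _ => hb i).ne' hsurface
  rw [Fin.prod_univ_three, Fin.prod_univ_three] at hprod
  have hsq : a 0 ^ 2 * a 1 ^ 2 * a 2 ^ 2 = b 0 ^ 2 * b 1 ^ 2 * b 2 ^ 2 := by
    rw [← mul_pow, ← mul_pow, ← mul_pow, ← mul_pow, hprod]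
  -- Inverting the semiaxes reverses the cubic and divides it by `z`, the form that
  -- `cubicIntegral_injective` expects.
  have hinv : ∀ c : Fin 3 → ℝ, (∀ i, 0 < c i) →
      c⁻¹ 0 ^ 2 + c⁻¹ 1 ^ 2 + c⁻¹ 2 ^ 2
        = (c 0 ^ 2 * c 1 ^ 2 + c 0 ^ 2 * c 2 ^ 2 + c 1 ^ 2 * c 2 ^ 2)
          / (c 0 ^ 2 * c 1 ^ 2 * c 2 ^ 2) ∧
      c⁻¹ 0 ^ 2 * c⁻¹ 1 ^ 2 + c⁻¹ 0 ^ 2 * c⁻¹ 2 ^ 2 + c⁻¹ 1 ^ 2 * c⁻¹ 2 ^ 2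
        = (c 0 ^ 2 + c 1 ^ 2 + c 2 ^ 2) / (c 0 ^ 2 * c 1 ^ 2 * c 2 ^ 2) ∧
      c⁻¹ 0 ^ 2 * c⁻¹ 1 ^ 2 * c⁻¹ 2 ^ 2 = 1 / (c 0 ^ 2 * c 1 ^ 2 * c 2 ^ 2) := by
    intro c hc
    have h0 := (hc 0).ne'
    have h1 := (hc 1).ne'
    have h2 := (hc 2).ne'
    simp only [Pi.inv_apply]
    refine ⟨?_, ?_, ?_⟩
    all_goals field_simp
    all_goals ring
  have hF := cubicIntegral_eq_of_sphereIntegral_eq hI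
  have hG := cubicIntegral_eq_of_sphereIntegral_eq hJ
  obtain ⟨ha₁, ha₂, ha₃⟩ := hinv a ha
  obtain ⟨hb₁, hb₂, hb₃⟩ := hinv b hb
  rw [ha₁, ha₂, ha₃, hb₁, hb₂, hb₃, hsq] at hG
  rw [hsq] at hF
  have hb0 := hb 0
  have hb1 := hb 1
  have hb2 := hb 2
  obtain ⟨hs₁, hs₂⟩ := cubicIntegral_injective (by positivity) (by positivity) (by positivity)
    (by positivity) (by positivity) hF hG
  obtain ⟨σ, hσ⟩ := exists_perm_of_symmetric_eq (p := fun i => a i ^ 2) (q := fun i => b i ^ 2)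
    (fun i => pow_pos (ha i) 2) hs₁ hs₂ hsq
  have hab : a = b ∘ σ := funext fun i =>
    (pow_left_inj₀ (ha i).le (hb (σ i)).le two_ne_zero).1 (hσ i)
  refine ⟨(φ.symm.trans (LinearIsometryEquiv.piLpCongrLeft 2 ℝ ℝ σ).toIsometryEquiv).trans ψ, ?_⟩
  rw [← standardEllipsoid_comp_perm b σ, ← hab, image_image, image_image]
  refine image_congr fun x _ => ?_
  simp
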